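/- Homology is taken with integer coefficients. For a homomorphism $f:\Gamma\to G$ of groups let $C_*(G,\Gamma)$ be the mapping cone of the induced map $C_*(f):C_*(\Gamma)\to C_*(G)$ of inhomogeneous bar complexes, so $C_n(G,\Gamma)=C_n(G)\oplus C_{n-1}(\Gamma)$ with differential $d(x,y)=(dx+f_*y,\,-dy)$, and let $H_2(G,\Gamma)$ be its second homology. A central $f$-extension of $G$ with kernel $A$ is a central extension $0\to A\to M\to G\to 1$ together with a homomorphism $\psi:\Gamma\to M$ (the structure map) lifting $f$. A map of central $f$-extensions is a homomorphism over $G$ that respects the structure maps; a map of central extensions of $G$ is a homomorphism over $G$. Choose a set-theoretic section $s$ of $M\to G$. The factor set $c(g,h)=s(g)s(h)s(gh)^{-1}\in A$ defines, by evaluation on cycles, a homomorphism $H_2(G)\to A$, and $(c,v)$ with $v(\gamma)=s(f(\gamma))\psi(\gamma)^{-1}\in A$ defines, by $[(x,y)]\mapsto c(x)+v(y)$, a homomorphism $H_2(G,\Gamma)\to A$; both are independent of $s$. Let $P$ be a perfect group. The universal Schur extension of $P$ is the central extension $0\to H_2(P)\to E\to P\to 1$ for which the resulting homomorphism $H_2(P)\to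 H_2(P)$ is the identity. For $f:\Gamma\to P$ the universal central $f$-extension is the central $f$-extension $0\to H_2(P,\Gamma)\to U\to P\to 1$, $\eta:\Gamma\to U$, for which the resulting homomorphism $H_2(P,\Gamma)\to H_2(P,\Gamma)$ is the identity. Let $E$ be the universal Schur extension of the perfect group $P$ and let $f:\Gamma\to P$ be any homomorphism. 1. Let $(U,\eta)$ be the universal central $f$-extension. There is a unique map $e:E\to U$ of central extensions of $P$, and its restriction to the kernels is the natural map $H_2(P)\to H_2(P,\Gamma)$. If $\tilde f:\Gamma\to E$ is a lift of $f$, then there is a unique map $u:U\to E$ of central $f$-extensions from $(U,\eta)$ to $(E,\tilde f)$; moreover $\ker u$ is central in $U$ and $u\circ e=\mathrm{id}_E$, so that $U$ is a split central extension of $E$. 2. If $f$ lifts to a homomorphism $\Gamma\to E$, then the induced map $H_2(\Gamma)\to H_2(P)$ is zero. 3. Let $C$ be a cyclic group and $f_x:C\to P$ a homomorphism. The sequence $$(\star)\qquad 0\to H_2(P)\to H_2(P,C)\to C\to 0,$$ whose second map is the connecting homomorphism $[(x,y)]\mapsto [y]\in H_1(C)=C$, is exact, and if $f_x$ lifts to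 a homomorphism $C\to E$, then $(\star)$ splits. Thus splitting of $(\star)$ is a necessary condition for the existence of a lift of $f_x$. -/

import Mathlib

open CategoryTheory

universe u v w

noncomputable section

/-! ### Integral group homology -/

/-- The integers as a trivial `G`-module. (Mathlib's group homology wants the coefficient ring and
the group in one universe, hence the `ULift`.) -/
abbrev intRep (G : Type u) [Group G] : Rep.{u} (ULift.{u} ℤ) G :=
  Rep.trivial (ULift.{u} ℤ) G (ULift.{u} ℤ)

/-- The integral bar complex `C_*(G; ℤ)` of inhomogeneous chains. -/
abbrev barChains (G : Type u) [Group G] : ChainComplex (ModuleCat.{u} (ULift.{u} ℤ)) ℕ :=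
  groupHomology.inhomogeneousChains (intRep G)

/-- The Schur multiplier `H₂(G) = H₂(G; ℤ)`. -/
abbrev schurH2 (G : Type u) [Group G] : ModuleCat.{u} (ULift.{u} ℤ) :=
  groupHomology (intRep G) 2

section Relative

variable {Γ G : Type u} [Group Γ] [Group G] (f : Γ →* G)

/-- The identity of `ℤ`, as a map of trivial modules over `f : Γ → G`. -/
def intRepHom : intRep Γ ⟶ Rep.res f (intRep G) :=
  Rep.ofHom ⟨LinearMap.id, fun _ => rfl⟩

/-- The chain map `C_*(f) : C_*(Γ) → C_*(G)`. -/
abbrev barMap : barChains Γ ⟶ barChains G :=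
  groupHomology.chainsMap f (intRepHom f)

/-- The homomorphism `H₂(Γ) → H₂(G)` induced by `f`. -/
abbrev schurH2Map : schurH2 Γ ⟶ schurH2 G :=
  groupHomology.map f (intRepHom f) 2

/-- The relative chains `C_*(G, Γ)`: the mapping cone of `C_*(f)`. In degree `n + 1` it is
`C_{n+1}(G) ⊕ C_n(Γ)` with differential `(x, y) ↦ (d x + f y, - d y)`. -/
abbrev relChains : ChainComplex (ModuleCat.{u} (ULift.{u} ℤ)) ℕ :=
  HomologicalComplex.homotopyCofiber (barMap f)

/-- The relative Schur multiplier `H₂(G, Γ) = H₂(G, Γ; ℤ)`. -/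
abbrev relH2 : ModuleCat.{u} (ULift.{u} ℤ) :=
  (relChains f).homology 2

/-- The homomorphism `H₂(G) → H₂(G, Γ)` of the long exact sequence of the pair. -/
abbrev toRelH2 : schurH2 G ⟶ relH2 f :=
  HomologicalComplex.homologyMap (HomologicalComplex.homotopyCofiber.inr (barMap f)) 2

/-- The component in `C₂(G)` of a relative 2-chain. -/
abbrev relFst : (relChains f).X 2 ⟶ (barChains G).X 2 :=
  HomologicalComplex.homotopyCofiber.sndX (barMap f) 2

/-- The component in `C₁(Γ)` of a relative 2-chain. -/
abbrev relSnd : (relChains f).X 2 ⟶ (barChains Γ).X 1 :=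
  HomologicalComplex.homotopyCofiber.fstX (barMap f) 2 1 rfl

/-- The map `C₁(Γ) → Γ_ab` sending the generator `[γ]` to the class of `γ`. -/
def finsuppToAb (Γ : Type u) [Group Γ] :
    ((Fin 1 → Γ) →₀ ULift.{u} ℤ) →ₗ[ULift.{u} ℤ] Additive (Abelianization Γ) :=
  Finsupp.lsum ℕ fun γ : Fin 1 → Γ =>
    LinearMap.toSpanSingleton (ULift.{u} ℤ) _ (Additive.ofMul (Abelianization.of (γ 0)))

/-- `finsuppToAb` as a morphism out of `C₁(Γ)`. -/
def chainsToAb (Γ : Type u) [Group Γ] :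
    (barChains Γ).X 1 ⟶ ModuleCat.of (ULift.{u} ℤ) (Additive (Abelianization Γ)) :=
  ModuleCat.ofHom (finsuppToAb Γ)

lemma finsuppToAb_single (g : Fin 1 → Γ) :
    finsuppToAb Γ (Finsupp.single g 1) = Additive.ofMul (Abelianization.of (g 0)) := by
  simp [finsuppToAb]

lemma d_chainsToAb (Γ : Type u) [Group Γ] : (barChains Γ).d 2 1 ≫ chainsToAb Γ = 0 := by
  rw [groupHomology.inhomogeneousChains.d_def]
  apply groupHomology.inhomogeneousChains.ext
  intro g
  refine ModuleCat.hom_ext (LinearMap.ext_ring ?_)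
  have h1 := groupHomology.inhomogeneousChains.d_single (A := intRep Γ) 1 g (1 : ULift.{u} ℤ)
  have h2 : finsuppToAb Γ (Finsupp.single (fun i => g i.succ) 1 +
      Finset.univ.sum fun j : Fin 2 => (-1 : ULift.{u} ℤ) ^ ((j : ℕ) + 1) •
        Finsupp.single (Fin.contractNth j (· * ·) g) (1 : ULift.{u} ℤ)) = 0 := by
    rw [Fin.sum_univ_two]
    simp only [map_add, map_smul, finsuppToAb_single]
    simp [Fin.contractNth]
  exact (congrArg (finsuppToAb Γ) h1).trans h2

/-- The connecting homomorphism `H₂(G, Γ) → H₁(Γ) = Γ_ab`: it sends the class of the relative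
cycle `(x, y)` to the class of `y`. -/
def relH2ToAb : relH2 f ⟶ ModuleCat.of (ULift.{u} ℤ) (Additive (Abelianization Γ)) :=
  (relChains f).homologyι 2 ≫
    (relChains f).descOpcycles (relSnd f ≫ chainsToAb Γ) 3 (by simp) (by
      have h := HomologicalComplex.homotopyCofiber.d_fstX_assoc (barMap f) 3 2 1 rfl rfl
        (chainsToAb Γ)
      rw [Preadditive.neg_comp, Category.assoc, d_chainsToAb, Limits.comp_zero, neg_zero] at h
      exact h)

end Relative

/-- For abelian `C`, the connecting homomorphism `H₂(G, C) → H₁(C) = C`. -/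
def relH2ToSelf {C G : Type u} [CommGroup C] [Group G] (f : C →* G) : relH2 f →+ Additive C :=
  (MonoidHom.toAdditive (Abelianization.equivOfComm (H := C)).symm.toMonoidHom).comp
    (relH2ToAb f).hom.toAddMonoidHom

/-! ### Central extensions and central `f`-extensions -/

/-- A central extension `0 → A → M → G → 1` of `G`. -/
structure CentralExt (A : Type*) [AddCommGroup A] (M : Type*) [Group M] (G : Type*) [Group G]
    extends GroupExtension (Multiplicative A) M G where
  central : inl.range ≤ Subgroup.center M

/-- A central `f`-extension of `G`, for `f : Γ → G`: a central extension `0 → A → M → G → 1`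
with a structure map `Γ → M` lifting `f`. -/
structure CentralFExt {Γ G : Type*} [Group Γ] [Group G] (f : Γ →* G)
    (A : Type*) [AddCommGroup A] (M : Type*) [Group M] extends CentralExt A M G where
  str : Γ →* M
  rightHom_comp_str : rightHom.comp str = f

namespace CentralExt

variable {A M G : Type*} [AddCommGroup A] [Group M] [Group G] (X : CentralExt A M G)

lemma exists_inl_mul {a b : M} (h : X.rightHom a = X.rightHom b) :
    ∃ n : A, X.inl (Multiplicative.ofAdd n) * b = a := by
  have hk : a * b⁻¹ ∈ X.inl.range := by
    rw [X.range_inl_eq_ker_rightHom, MonoidHom.mem_ker, map_mul, map_inv, h, mul_inv_cancel]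
  obtain ⟨n, hn⟩ := hk
  exact ⟨n.toAdd, by simp [hn]⟩

/-- For `a, b` in the same fibre of `M → G`, the element `a b⁻¹` of the kernel `A`. -/
def diff (a b : M) (h : X.rightHom a = X.rightHom b) : A :=
  (X.exists_inl_mul h).choose

lemma inl_diff_mul (a b : M) (h : X.rightHom a = X.rightHom b) :
    X.inl (Multiplicative.ofAdd (X.diff a b h)) * b = a :=
  (X.exists_inl_mul h).choose_spec

/-- The factor set of a set-theoretic section `s`: the 2-cocycle
`c(g, h) = s(g) s(h) s(gh)⁻¹` with values in `A`. -/
def factorSet (s : X.Section) (g h : G) : A :=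
  X.diff (s.toFun g * s.toFun h) (s.toFun (g * h)) (by
    rw [map_mul, s.rightInverse_rightHom, s.rightInverse_rightHom, s.rightInverse_rightHom])

end CentralExt

/-- For a central `f`-extension with structure map `ψ` and a set-theoretic section `s`, the
1-cochain `v(γ) = s(f(γ)) ψ(γ)⁻¹` with values in `A`; it is a null-cohomology of the pullback of
the factor set of `s` to `Γ`. -/
def CentralFExt.strCochain {Γ G A M : Type*} [Group Γ] [Group G] [AddCommGroup A] [Group M]
    {f : Γ →* G} (X : CentralFExt f A M) (s : X.Section) (γ : Γ) : A :=
  X.diff (s.toFun (f γ)) (X.str γ) (by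
    rw [s.rightInverse_rightHom, ← MonoidHom.comp_apply, X.rightHom_comp_str])

/-- Evaluation of a 1-cochain `v : G → A` on an integral bar 1-chain. -/
def evalChain₁ {G : Type u} [Group G] {A : Type*} [AddCommGroup A] (v : G → A)
    (y : (barChains G).X 1) : A :=
  Finsupp.sum (y : (Fin 1 → G) →₀ ULift.{u} ℤ) fun g n => n.down • v (g 0)

/-- Evaluation of a 2-cochain `c : G × G → A` on an integral bar 2-chain. -/
def evalChain₂ {G : Type u} [Group G] {A : Type*} [AddCommGroup A] (c : G → G → A)
    (x : (barChains G).X 2) : A :=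
  Finsupp.sum (x : (Fin 2 → G) →₀ ULift.{u} ℤ) fun g n => n.down • c (g 0) (g 1)

/-- `X.HasClass χ`: the class of the central extension `X` in `H²(G; A)` is sent to `χ` by the
universal coefficient map `H²(G; A) → Hom(H₂(G), A)`, that is, `χ` is evaluation of the factor
set on cycles. (This does not depend on the section `s`, and sections exist.) -/
def CentralExt.HasClass {G : Type u} [Group G] {A M : Type*} [AddCommGroup A] [Group M]
    (X : CentralExt A M G) (χ : schurH2 G →+ A) : Prop :=
  ∀ (s : X.Section) (z : (barChains G).cycles 2),
    χ ((barChains G).homologyπ 2 z) =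
      evalChain₂ (X.factorSet s) ((barChains G).iCycles 2 z)

/-- `X.HasClass χ`: the class of the central `f`-extension `X` in `H²(G, Γ; A)`, represented by
the factor set and the null-cohomology given by the structure map, is sent to `χ` by the universal
coefficient map `H²(G, Γ; A) → Hom(H₂(G, Γ), A)`. (This does not depend on the section `s`, and
sections exist.) -/
def CentralFExt.HasClass {Γ G : Type u} [Group Γ] [Group G] {f : Γ →* G} {A M : Type*}
    [AddCommGroup A] [Group M] (X : CentralFExt f A M) (χ : relH2 f →+ A) : Prop :=
  ∀ (s : X.Section) (z : (relChains f).cycles 2),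
    χ ((relChains f).homologyπ 2 z) =
      evalChain₂ (X.factorSet s) (relFst f ((relChains f).iCycles 2 z)) +
        evalChain₁ (X.strCochain s) (relSnd f ((relChains f).iCycles 2 z))

/-- The universal Schur extension of a perfect group `P`: the central extension with kernel `H₂(P)`
whose class corresponds to the identity in `Hom(H₂(P), H₂(P))`. -/
def CentralExt.IsSchur {P : Type u} [Group P] {E : Type*} [Group E]
    (X : CentralExt (schurH2 P) E P) : Prop :=
  X.HasClass (AddMonoidHom.id (schurH2 P))

/-- The universal central `f`-extension (for `f` surjective on abelianizations): the central
`f`-extension with kernel `H₂(G, Γ)` whose class corresponds to the identity in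
`Hom(H₂(G, Γ), H₂(G, Γ))`. -/
def CentralFExt.IsUniversal {Γ G : Type u} [Group Γ] [Group G] {f : Γ →* G} {U : Type*} [Group U]
    (X : CentralFExt f (relH2 f) U) : Prop :=
  X.HasClass (AddMonoidHom.id (relH2 f))

end

/-! Everything takes place at the level of cochains. Since H₁(P) = 0, every 1-chain of P is a
boundary, so a 2-cochain that vanishes on all 2-cycles is a coboundary
(`exists_coboundary_of_isPerfect`). Hence an extension of P is controlled by the homomorphism that
its factor set defines on H₂(P).

Existence of maps: if χ carries one factor set to another up to δw, then a·s(g) ↦ (χ(a) + w(g))·t(g)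
is a homomorphism (`CentralExt.exists_monoidHom`). Uniqueness: two maps over P differ by a
homomorphism θ to the kernel. The relation θ∘c = δ(θ∘s) makes θ∘c vanish on cycles; the factor set
of a universal extension evaluates to the identity, so θ is zero on the kernel. It then factors
through the perfect group P and is trivial. The relative case runs in the same way with pairs (c,
v).

A lift of f turns E into a central f-extension with a class χ : H₂(P, Γ) → H₂(P), and universality
of U gives u. Its kernel is central because u is a map over P, and u∘e = id by uniqueness. The same
χ is a retraction of H₂(P) → H₂(P, Γ), which splits (⋆). A lift also makes the factor set a
coboundary on Γ, whence H₂(f) = 0.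

Injectivity in (⋆) needs H₂(C) → H₂(P) to vanish with no lift given. The preimage in E of the image
of C is central-by-cyclic, hence abelian, so characters of H₂(P) extend to it and turn the factor
set on C into coboundaries. -/

noncomputable section

/-! ### Cycles and boundaries of complexes of modules -/

section Complexes

variable {R : Type u} [Ring R] (K : ChainComplex (ModuleCat.{u} R) ℕ)

lemma iCycles_injective (n : ℕ) : Function.Injective (K.iCycles n) :=
  (ModuleCat.mono_iff_injective _).1 inferInstance

lemma homologyπ_surjective (n : ℕ) : Function.Surjective (K.homologyπ n) :=
  (ModuleCat.epi_iff_surjective _).1 inferInstance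

lemma d_iCycles_apply (n m : ℕ) (z : K.cycles n) : K.d n m (K.iCycles n z) = 0 := by
  rw [← ConcreteCategory.comp_apply, K.iCycles_d]
  rfl

lemma exists_iCycles_eq (n : ℕ) (x : K.X (n + 1)) (hx : K.d (n + 1) n x = 0) :
    ∃ z, K.iCycles (n + 1) z = x :=
  ⟨K.cyclesMk (C := ModuleCat R) x n (by simp) hx, K.i_cyclesMk (C := ModuleCat R) x n (by simp) hx⟩

lemma homologyπ_eq_zero_iff (n : ℕ) (z : K.cycles n) :
    K.homologyπ n z = 0 ↔ ∃ b, K.d (n + 1) n b = K.iCycles n z := by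
  have hex : (ShortComplex.mk (K.toCycles (n + 1) n) (K.homologyπ n) (by simp)).Exact :=
    ShortComplex.exact_of_g_is_cokernel _ (K.homologyIsCokernel (n + 1) n (by simp))
  constructor
  · intro h
    obtain ⟨b, hb⟩ := (ShortComplex.moduleCat_exact_iff _).1 hex z h
    refine ⟨b, ?_⟩
    rw [← hb, ← K.toCycles_i]
    rfl
  · rintro ⟨b, hb⟩
    have : z = K.toCycles (n + 1) n b := iCycles_injective K n (by
      rw [← hb, ← K.toCycles_i]
      rfl)
    rw [this, ← ConcreteCategory.comp_apply, K.toCycles_comp_homologyπ]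
    rfl

variable {K} {L : ChainComplex (ModuleCat.{u} R) ℕ} (φ : K ⟶ L)

lemma homologyMap_homologyπ_apply (n : ℕ) (z : K.cycles n) :
    HomologicalComplex.homologyMap φ n (K.homologyπ n z) =
      L.homologyπ n (HomologicalComplex.cyclesMap φ n z) := by
  rw [← ConcreteCategory.comp_apply, HomologicalComplex.homologyπ_naturality,
    ConcreteCategory.comp_apply]

lemma iCycles_cyclesMap_apply (n : ℕ) (z : K.cycles n) :
    L.iCycles n (HomologicalComplex.cyclesMap φ n z) = φ.f n (K.iCycles n z) := by
  rw [← ConcreteCategory.comp_apply, HomologicalComplex.cyclesMap_i, ConcreteCategory.comp_apply]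

/-- A homomorphism on cycles that vanishes on boundaries descends to homology. -/
lemma exists_addMonoidHom_homology {A : Type*} [AddCommGroup A] (n : ℕ) (θ : K.X n →+ A)
    (h : ∀ z : K.cycles n, K.homologyπ n z = 0 → θ (K.iCycles n z) = 0) :
    ∃ χ : K.homology n →+ A, ∀ z, χ (K.homologyπ n z) = θ (K.iCycles n z) := by
  let p : K.cycles n →+ K.homology n := (K.homologyπ n).hom.toAddMonoidHom
  let q : K.cycles n →+ A := θ.comp (K.iCycles n).hom.toAddMonoidHom
  refine ⟨p.liftOfSurjective (homologyπ_surjective K n) ⟨q, fun z hz => h z hz⟩, fun z => ?_⟩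
  exact p.liftOfRightInverse_comp_apply _ _ ⟨q, fun z hz => h z hz⟩ z

end Complexes

/-! ### The mapping cone of `C_*(f)` -/

section Cone

variable {Γ G : Type u} [Group Γ] [Group G] (f : Γ →* G)

open HomologicalComplex

/-- The relative chain `(x, y)`. -/
def relMk (n : ℕ) (x : (barChains G).X (n + 1)) (y : (barChains Γ).X n) : (relChains f).X (n + 1) :=
  homotopyCofiber.inrX (barMap f) (n + 1) x + homotopyCofiber.inlX (barMap f) n (n + 1) rfl y

@[simp] lemma sndX_relMk (n : ℕ) (x : (barChains G).X (n + 1)) (y : (barChains Γ).X n) :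
    homotopyCofiber.sndX (barMap f) (n + 1) (relMk f n x y) = x := by
  have h₁ := ConcreteCategory.congr_hom (homotopyCofiber.inrX_sndX (barMap f) (n + 1)) x
  have h₂ := ConcreteCategory.congr_hom (homotopyCofiber.inlX_sndX (barMap f) n (n + 1) rfl) y
  exact (map_add _ _ _).trans ((congrArg₂ (· + ·) h₁ h₂).trans (add_zero _))

@[simp] lemma fstX_relMk (n : ℕ) (x : (barChains G).X (n + 1)) (y : (barChains Γ).X n) :
    homotopyCofiber.fstX (barMap f) (n + 1) n rfl (relMk f n x y) = y := by
  have h₁ := ConcreteCategory.congr_hom (homotopyCofiber.inrX_fstX (barMap f) (n + 1) n rfl) x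
  have h₂ := ConcreteCategory.congr_hom (homotopyCofiber.inlX_fstX (barMap f) n (n + 1) rfl) y
  exact (map_add _ _ _).trans ((congrArg₂ (· + ·) h₁ h₂).trans (zero_add _))

/-- The identity of the cone is the sum of the two projections followed by the two inclusions. -/
lemma relChains_ext (n : ℕ) {a b : (relChains f).X (n + 1)}
    (h₁ : homotopyCofiber.sndX (barMap f) (n + 1) a = homotopyCofiber.sndX (barMap f) (n + 1) b)
    (h₂ : homotopyCofiber.fstX (barMap f) (n + 1) n rfl a =
      homotopyCofiber.fstX (barMap f) (n + 1) n rfl b) : a = b := by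
  have key : homotopyCofiber.sndX (barMap f) (n + 1) ≫ homotopyCofiber.inrX (barMap f) (n + 1) +
      homotopyCofiber.fstX (barMap f) (n + 1) n rfl ≫
        homotopyCofiber.inlX (barMap f) n (n + 1) rfl = 𝟙 _ := by
    apply homotopyCofiber.ext_to_X (barMap f) (n + 1) n rfl
    · simp [homotopyCofiber.inlX_fstX (barMap f) n (n + 1) rfl,
        homotopyCofiber.inrX_fstX (barMap f) (n + 1) n rfl]
    · simp [homotopyCofiber.inlX_sndX (barMap f) n (n + 1) rfl]
  have hk (a : (relChains f).X (n + 1)) : relMk f n (homotopyCofiber.sndX (barMap f) (n + 1) a)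
      (homotopyCofiber.fstX (barMap f) (n + 1) n rfl a) = a :=
    ConcreteCategory.congr_hom key a
  rw [← hk a, ← hk b, h₁, h₂]

lemma sndX_d_apply (n : ℕ) (a : (relChains f).X (n + 1)) :
    homotopyCofiber.sndX (barMap f) n ((relChains f).d (n + 1) n a) =
      (barMap f).f n (homotopyCofiber.fstX (barMap f) (n + 1) n rfl a) +
        (barChains G).d (n + 1) n (homotopyCofiber.sndX (barMap f) (n + 1) a) :=
  ConcreteCategory.congr_hom (homotopyCofiber.d_sndX (barMap f) (n + 1) n rfl) a

lemma fstX_d_apply (n : ℕ) (a : (relChains f).X (n + 1 + 1)) :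
    homotopyCofiber.fstX (barMap f) (n + 1) n rfl ((relChains f).d (n + 1 + 1) (n + 1) a) =
      -(barChains Γ).d (n + 1) n (homotopyCofiber.fstX (barMap f) (n + 1 + 1) (n + 1) rfl a) :=
  ConcreteCategory.congr_hom (homotopyCofiber.d_fstX (barMap f) (n + 1 + 1) (n + 1) n rfl rfl) a

end Cone

/-! ### Evaluation of cochains -/

section Eval

variable {Γ G : Type u} [Group Γ] [Group G] (f : Γ →* G) {A B : Type*} [AddCommGroup A]
  [AddCommGroup B]

/-- Evaluation of cochains with an arbitrary index type, as a homomorphism. -/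
def evalHom {ι : Type u} (c : ι → A) : (ι →₀ ULift.{u} ℤ) →+ A :=
  Finsupp.liftAddHom fun i =>
    (AddMonoidHom.mk' (fun n : ULift.{u} ℤ => n.down • c i) fun a b => add_smul a.down b.down (c i))

lemma evalHom_single {ι : Type u} (c : ι → A) (i : ι) (n : ULift.{u} ℤ) :
    evalHom c (Finsupp.single i n) = n.down • c i := by
  simp [evalHom]

/-- `evalChain₁` as a homomorphism. -/
def evalHom₁ (v : G → A) : (barChains G).X 1 →+ A := evalHom fun g : Fin 1 → G => v (g 0)

/-- `evalChain₂` as a homomorphism. -/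
def evalHom₂ (c : G → G → A) : (barChains G).X 2 →+ A :=
  evalHom fun g : Fin 2 → G => c (g 0) (g 1)

lemma barChains_d_single (g : Fin 2 → G) (n : ULift.{u} ℤ) :
    (barChains G).d 2 1 (Finsupp.single g n) =
      (Finsupp.single ![g 1] n - Finsupp.single ![g 0 * g 1] n + Finsupp.single ![g 0] n :
        (Fin 1 → G) →₀ ULift.{u} ℤ) := by
  rw [groupHomology.inhomogeneousChains.d_def]
  have h1 := groupHomology.inhomogeneousChains.d_single (A := intRep G) 1 g n
  refine h1.trans ?_
  rw [Fin.sum_univ_two]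
  have e1 : (fun i : Fin 1 => g i.succ) = ![g 1] := by ext i; fin_cases i; rfl
  have e2 : Fin.contractNth 0 (· * ·) g = ![g 0 * g 1] := by ext i; fin_cases i; rfl
  have e3 : Fin.contractNth 1 (· * ·) g = ![g 0] := by ext i; fin_cases i; rfl
  rw [e1, e2, e3]
  simp [sub_eq_add_neg, add_assoc]

lemma barMap_single (n : ℕ) (g : Fin n → Γ) (a : ULift.{u} ℤ) :
    (barMap f).f n (Finsupp.single g a) = (Finsupp.single (f ∘ g) a : (Fin n → G) →₀ ULift.{u} ℤ) :=
  groupHomology.chainsMap_f_single ..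

/-- Chains are free on tuples, so each identity between evaluations below is checked on generators.
-/
lemma addHom_ext_barChains (n : ℕ) {θ₁ θ₂ : (barChains G).X n →+ A}
    (h : ∀ (g : Fin n → G) (a : ULift.{u} ℤ), θ₁ (Finsupp.single g a : (Fin n → G) →₀ ULift.{u} ℤ) =
      θ₂ (Finsupp.single g a : (Fin n → G) →₀ ULift.{u} ℤ)) (x : (barChains G).X n) :
    θ₁ x = θ₂ x :=
  DFunLike.congr_fun (Finsupp.addHom_ext h : (θ₁ : ((Fin n → G) →₀ ULift.{u} ℤ) →+ A) = θ₂) x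

lemma evalChain₁_d (v : G → A) (x : (barChains G).X 2) :
    evalChain₁ v ((barChains G).d 2 1 x) = evalChain₂ (fun g h => v g + v h - v (g * h)) x := by
  refine addHom_ext_barChains 2 (θ₁ := (evalHom₁ v).comp ((barChains G).d 2 1).hom.toAddMonoidHom)
    (θ₂ := evalHom₂ fun g h => v g + v h - v (g * h)) (fun g a => ?_) x
  refine (congrArg (evalHom₁ v) (barChains_d_single g a)).trans ?_
  simp only [evalHom₁, evalHom₂]
  erw [map_add, map_sub]
  simp only [evalHom_single]
  simp [smul_add, smul_sub]
  abel

lemma evalChain₁_barMap (v : G → A) (y : (barChains Γ).X 1) :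
    evalChain₁ v ((barMap f).f 1 y) = evalChain₁ (fun γ => v (f γ)) y := by
  refine addHom_ext_barChains 1 (θ₁ := (evalHom₁ v).comp ((barMap f).f 1).hom.toAddMonoidHom)
    (θ₂ := evalHom₁ fun γ => v (f γ)) (fun g a => ?_) y
  refine (congrArg (evalHom₁ v) (barMap_single f 1 g a)).trans ?_
  simp only [evalHom₁]
  erw [evalHom_single, evalHom_single]
  rfl

lemma evalChain₂_barMap (c : G → G → A) (y : (barChains Γ).X 2) :
    evalChain₂ c ((barMap f).f 2 y) = evalChain₂ (fun γ γ' => c (f γ) (f γ')) y := by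
  refine addHom_ext_barChains 2 (θ₁ := (evalHom₂ c).comp ((barMap f).f 2).hom.toAddMonoidHom)
    (θ₂ := evalHom₂ fun γ γ' => c (f γ) (f γ')) (fun g a => ?_) y
  refine (congrArg (evalHom₂ c) (barMap_single f 2 g a)).trans ?_
  simp only [evalHom₂]
  erw [evalHom_single, evalHom_single]
  rfl

lemma map_evalChain₁ (θ : A →+ B) (v : G → A) (x : (barChains G).X 1) :
    θ (evalChain₁ v x) = evalChain₁ (fun g => θ (v g)) x := by
  refine addHom_ext_barChains 1 (θ₁ := θ.comp (evalHom₁ v)) (θ₂ := evalHom₁ fun g => θ (v g))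
    (fun g a => ?_) x
  simp only [evalHom₁]
  erw [AddMonoidHom.comp_apply, evalHom_single, evalHom_single, map_zsmul]

lemma map_evalChain₂ (θ : A →+ B) (c : G → G → A) (x : (barChains G).X 2) :
    θ (evalChain₂ c x) = evalChain₂ (fun g h => θ (c g h)) x := by
  refine addHom_ext_barChains 2 (θ₁ := θ.comp (evalHom₂ c)) (θ₂ := evalHom₂ fun g h => θ (c g h))
    (fun g a => ?_) x
  simp only [evalHom₂]
  erw [AddMonoidHom.comp_apply, evalHom_single, evalHom_single, map_zsmul]

lemma evalChain₁_sub (v v' : G → A) (x : (barChains G).X 1) :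
    evalChain₁ (fun g => v g - v' g) x = evalChain₁ v x - evalChain₁ v' x := by
  refine addHom_ext_barChains 1 (θ₁ := evalHom₁ fun g => v g - v' g) (θ₂ := evalHom₁ v - evalHom₁ v')
    (fun g a => ?_) x
  simp only [evalHom₁]
  erw [AddMonoidHom.sub_apply, evalHom_single, evalHom_single, evalHom_single, smul_sub]

lemma evalChain₂_sub (c c' : G → G → A) (x : (barChains G).X 2) :
    evalChain₂ (fun g h => c g h - c' g h) x = evalChain₂ c x - evalChain₂ c' x := by
  refine addHom_ext_barChains 2 (θ₁ := evalHom₂ fun g h => c g h - c' g h)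
    (θ₂ := evalHom₂ c - evalHom₂ c')    (fun g a => ?_) x
  simp only [evalHom₂]
  erw [AddMonoidHom.sub_apply, evalHom_single, evalHom_single, evalHom_single, smul_sub]

/-- `C₁(G) → C₀(G)` vanishes, the coefficients being trivial. -/
lemma barChains_d_one_zero (y : (barChains G).X 1) : (barChains G).d 1 0 y = 0 := by
  refine addHom_ext_barChains 1 (A := (barChains G).X 0)
    (θ₁ := ((barChains G).d 1 0).hom.toAddMonoidHom) (θ₂ := 0) (fun g a => ?_) y
  change (barChains G).d 1 0 (Finsupp.single g a) = 0
  rw [groupHomology.inhomogeneousChains.d_def]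
  have h1 := groupHomology.inhomogeneousChains.d_single (A := intRep G) 0 g a
  refine h1.trans ?_
  rw [Fin.sum_univ_one, Subsingleton.elim (Fin.contractNth (0 : Fin 1) (· * ·) g) fun i => g i.succ]
  simp

/-- Coboundaries vanish on cycles. -/
lemma evalChain₂_coboundary_iCycles (w : G → A) (z : (barChains G).cycles 2) :
    evalChain₂ (fun g h => w g + w h - w (g * h)) ((barChains G).iCycles 2 z) = 0 := by
  rw [← evalChain₁_d, d_iCycles_apply]
  exact map_zero (evalHom₁ w)

end Eval

/-! ### First homology and perfect groups -/

section Perfect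

variable {G : Type u} [Group G] {A : Type*} [AddCommGroup A]

/-- The generator `[g]` of `C₁(G)`. -/
def barOne (g : G) : (barChains G).X 1 :=
  (Finsupp.single ![g] 1 : (Fin 1 → G) →₀ ULift.{u} ℤ)

/-- The generator `[g|h]` of `C₂(G)`. -/
def barTwo (g h : G) : (barChains G).X 2 :=
  (Finsupp.single ![g, h] 1 : (Fin 2 → G) →₀ ULift.{u} ℤ)

lemma evalChain₁_barOne (v : G → A) (g : G) : evalChain₁ v (barOne g) = v g :=
  (evalHom_single (fun g : Fin 1 → G => v (g 0)) ![g] 1).trans (by simp)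

lemma evalChain₂_barTwo (c : G → G → A) (g h : G) : evalChain₂ c (barTwo g h) = c g h :=
  (evalHom_single (fun g : Fin 2 → G => c (g 0) (g 1)) ![g, h] 1).trans (by simp)

lemma d_barTwo (g h : G) :
    (barChains G).d 2 1 (barTwo g h) = barOne h - barOne (g * h) + barOne g :=
  barChains_d_single ![g, h] 1

lemma chainsToAb_single (g : Fin 1 → G) (a : ULift.{u} ℤ) :
    chainsToAb G (Finsupp.single g a : (Fin 1 → G) →₀ ULift.{u} ℤ) =
      a • Additive.ofMul (Abelianization.of (g 0)) := by
  change finsuppToAb G (Finsupp.single g a) = _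
  simp [finsuppToAb]

lemma chainsToAb_barOne (g : G) :
    chainsToAb G (barOne g) = Additive.ofMul (Abelianization.of g) :=
  (chainsToAb_single ![g] 1).trans (one_smul _ _)

/-- The kernel of `C₁(G) → G_ab` consists of boundaries. -/
lemma exists_d_eq_of_chainsToAb_eq_zero (y : (barChains G).X 1) (hy : chainsToAb G y = 0) :
    ∃ x, (barChains G).d 2 1 x = y := by
  let N : Submodule (ULift.{u} ℤ) ((barChains G).X 1) := LinearMap.range ((barChains G).d 2 1).hom
  -- Modulo boundaries g ↦ [g] is multiplicative, because d[g|h] = [h] - [gh] + [g]. It therefore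
  -- factors through the abelianization, and the induced `l` recovers the class of a chain from its
  -- image there.
  let η : G →* Multiplicative ((barChains G).X 1 ⧸ N) :=
    MonoidHom.mk' (fun g => .ofAdd (N.mkQ (barOne g))) fun g h => by
      have h0 : N.mkQ ((barChains G).d 2 1 (barTwo g h)) = 0 :=
        (Submodule.Quotient.mk_eq_zero N).2 ⟨_, rfl⟩
      rw [d_barTwo, map_add, map_sub] at h0
      rw [← ofAdd_add]
      congr 1
      rw [← sub_eq_zero, ← neg_eq_zero, ← h0]
      abel
  let l : Additive (Abelianization G) →+ (barChains G).X 1 ⧸ N :=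
    MonoidHom.toAdditiveLeft (Abelianization.lift η)
  have key : l (chainsToAb G y) = N.mkQ y := by
    refine addHom_ext_barChains 1 (θ₁ := l.comp (chainsToAb G).hom.toAddMonoidHom)
      (θ₂ := N.mkQ.toAddMonoidHom) (fun g a => ?_) y
    have h1 : l (chainsToAb G (Finsupp.single g a : (Fin 1 → G) →₀ ULift.{u} ℤ)) =
        a.down • N.mkQ (barOne (g 0)) := by
      rw [chainsToAb_single]
      exact (map_zsmul l a.down _).trans (congrArg (a.down • ·)
        (congrArg Multiplicative.toAdd (Abelianization.lift_apply_of η (g 0))))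
    refine h1.trans ?_
    rw [← map_zsmul]
    refine congrArg N.mkQ ?_
    have hg : ![g 0] = g := by ext i; fin_cases i; rfl
    change a.down • (Finsupp.single ![g 0] 1 : (Fin 1 → G) →₀ ULift.{u} ℤ) = Finsupp.single g a
    rw [hg, Finsupp.smul_single]
    congr 1
    exact ULift.ext _ _ (by simp)
  rw [hy, map_zero] at key
  exact (Submodule.Quotient.mk_eq_zero N).1 key.symm

variable [Group.IsPerfect G]

lemma monoidHom_eq_one_of_isPerfect (μ : G →* Multiplicative A) (g : G) : μ g = 1 :=
  Abelianization.commutator_subset_ker μ Group.IsPerfect.mem_commutator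

lemma exists_d_eq_of_isPerfect (y : (barChains G).X 1) : ∃ x, (barChains G).d 2 1 x = y := by
  apply exists_d_eq_of_chainsToAb_eq_zero
  refine addHom_ext_barChains 1 (θ₁ := (chainsToAb G).hom.toAddMonoidHom) (θ₂ := 0)
    (fun g a => ?_) y
  refine (chainsToAb_single g a).trans ?_
  have : Abelianization.of (g 0) = 1 := (QuotientGroup.eq_one_iff _).2 Group.IsPerfect.mem_commutator
  rw [this]
  exact smul_zero _

/-- A 2-cochain of a perfect group that vanishes on cycles is a coboundary. -/
lemma exists_coboundary_of_isPerfect (c : G → G → A)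
    (hc : ∀ x, (barChains G).d 2 1 x = 0 → evalChain₂ c x = 0) :
    ∃ w : G → A, ∀ g h, c g h = w g + w h - w (g * h) := by
  -- With d x_g = [g], the chain x_h - x_{gh} + x_g - [g|h] is a cycle. Its vanishing under c says
  -- exactly that c = δw for w(g) = c(x_g); no cocycle condition on c is needed.
  choose x hx using fun g : G => exists_d_eq_of_isPerfect (barOne g)
  refine ⟨fun g => evalChain₂ c (x g), fun g h => ?_⟩
  have h0 := hc (x h - x (g * h) + x g - barTwo g h) (by
    rw [map_sub, map_add, map_sub, hx, hx, hx, d_barTwo, sub_self])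
  have h1 : evalHom₂ c (x h) - evalHom₂ c (x (g * h)) + evalHom₂ c (x g) -
      evalHom₂ c (barTwo g h) = 0 := by
    rw [← map_sub, ← map_add, ← map_sub]
    exact h0
  have h2 : evalHom₂ c (barTwo g h) = c g h := evalChain₂_barTwo c g h
  rw [h2, sub_eq_zero] at h1
  rw [← h1]
  change _ = evalHom₂ c (x g) + evalHom₂ c (x h) - evalHom₂ c (x (g * h))
  abel

end Perfect

/-! ### Homomorphisms between central extensions -/

namespace CentralExt

variable {A B M N G : Type*} [AddCommGroup A] [AddCommGroup B] [Group M] [Group N] [Group G]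
  (X : CentralExt A M G) (Y : CentralExt B N G)

lemma inl_mul_comm (a : A) (m : M) : X.inl (.ofAdd a) * m = m * X.inl (.ofAdd a) :=
  (Subgroup.mem_center_iff.1 (X.central ⟨_, rfl⟩) m).symm

lemma inl_add (a b : A) : X.inl (.ofAdd (a + b)) = X.inl (.ofAdd a) * X.inl (.ofAdd b) :=
  map_mul X.inl (.ofAdd a) (.ofAdd b)

lemma inl_mul_mul_inl_mul (a b : A) (m n : M) :
    X.inl (.ofAdd a) * m * (X.inl (.ofAdd b) * n) = X.inl (.ofAdd (a + b)) * (m * n) := by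
  rw [inl_add, mul_assoc, ← mul_assoc m, ← X.inl_mul_comm b m]
  simp only [mul_assoc]

lemma inl_mul_cancel {a b : A} {m : M} (h : X.inl (.ofAdd a) * m = X.inl (.ofAdd b) * m) : a = b :=
  Multiplicative.ofAdd.injective (X.inl_injective (mul_right_cancel h))

lemma rightHom_inl_mul (a : A) (m : M) : X.rightHom (X.inl (.ofAdd a) * m) = X.rightHom m := by
  rw [map_mul, X.toGroupExtension.rightHom_inl, one_mul]

lemma inl_factorSet_mul (s : X.Section) (g h : G) :
    X.inl (.ofAdd (X.factorSet s g h)) * s.toFun (g * h) = s.toFun g * s.toFun h :=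
  X.inl_diff_mul _ _ _

lemma exists_inl_mul_section (s : X.Section) (m : M) :
    ∃ a, X.inl (.ofAdd a) * s.toFun (X.rightHom m) = m :=
  X.exists_inl_mul (by rw [s.rightInverse_rightHom])

lemma inl_mul_section_injective (s : X.Section) {a b : A} {g h : G}
    (H : X.inl (.ofAdd a) * s.toFun g = X.inl (.ofAdd b) * s.toFun h) : a = b ∧ g = h := by
  have hg := congrArg X.rightHom H
  rw [rightHom_inl_mul, rightHom_inl_mul, s.rightInverse_rightHom, s.rightInverse_rightHom] at hg
  subst hg
  exact ⟨X.inl_mul_cancel H, rfl⟩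

variable {X Y} in
/-- A homomorphism of kernels that carries the factor set to the factor set, up to a coboundary,
extends to the extensions. -/
lemma exists_monoidHom (s : X.Section) (t : Y.Section) (χ : A →+ B) (w : G → B)
    (h : ∀ g h, χ (X.factorSet s g h) - Y.factorSet t g h = w g + w h - w (g * h)) :
    ∃ φ : M →* N, Y.rightHom.comp φ = X.rightHom ∧
      (∀ a, φ (X.inl (.ofAdd a)) = Y.inl (.ofAdd (χ a))) ∧
      ∀ g, φ (s.toFun g) = Y.inl (.ofAdd (w g)) * t.toFun g := by
  choose r hr using X.exists_inl_mul_section s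
  -- Each element has a unique normal form a·s(g), and the required values on the kernel and on the
  -- section force this formula.
  let F : M → N := fun m => Y.inl (.ofAdd (χ (r m) + w (X.rightHom m))) * t.toFun (X.rightHom m)
  have hF (a : A) (g : G) :
      F (X.inl (.ofAdd a) * s.toFun g) = Y.inl (.ofAdd (χ a + w g)) * t.toFun g := by
    obtain ⟨h₁, h₂⟩ := X.inl_mul_section_injective s (hr (X.inl (.ofAdd a) * s.toFun g))
    simp only [F]
    rw [h₁, h₂]
  let φ : M →* N := MonoidHom.mk' F fun m n => by
    obtain ⟨a, ha⟩ := X.exists_inl_mul_section s m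
    obtain ⟨b, hb⟩ := X.exists_inl_mul_section s n
    generalize X.rightHom m = g at ha
    generalize X.rightHom n = k at hb
    subst ha hb
    rw [inl_mul_mul_inl_mul, ← inl_factorSet_mul, ← mul_assoc, ← inl_add, hF, hF, hF,
      inl_mul_mul_inl_mul, ← inl_factorSet_mul, ← mul_assoc, ← inl_add]
    congr 3
    have := h g k
    rw [sub_eq_iff_eq_add] at this
    rw [map_add, map_add, this]
    abel
  have hφ (a : A) (g : G) :
      φ (X.inl (.ofAdd a) * s.toFun g) = Y.inl (.ofAdd (χ a + w g)) * t.toFun g := hF a g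
  have hs (g : G) : φ (s.toFun g) = Y.inl (.ofAdd (w g)) * t.toFun g := by
    have := hφ 0 g
    rwa [ofAdd_zero, map_one, one_mul, map_zero, zero_add] at this
  refine ⟨φ, MonoidHom.ext fun m => ?_, fun a => ?_, hs⟩
  · change Y.rightHom (F m) = _
    rw [rightHom_inl_mul, t.rightInverse_rightHom]
  -- The section need not satisfy s(1) = 1, so the value at a is obtained from a·s(1) by cancelling
  -- φ(s(1)).
  · have := hφ a 1
    rw [map_mul, hs, inl_add, mul_assoc] at this
    exact mul_right_cancel this

variable {X Y} in
/-- Two homomorphisms over `G` into a central extension differ by a homomorphism to the kernel. -/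
lemma exists_eq_inl_mul {H : Type*} [Group H] {φ φ' : H →* N}
    (h : Y.rightHom.comp φ = Y.rightHom.comp φ') :
    ∃ θ : H →* Multiplicative B, ∀ m, φ m = Y.inl (θ m) * φ' m := by
  choose θ hθ using fun m => Y.exists_inl_mul (DFunLike.congr_fun h m)
  refine ⟨MonoidHom.mk' (fun m => .ofAdd (θ m)) fun m n => ?_, fun m => (hθ m).symm⟩
  rw [← ofAdd_add]
  refine congrArg _ (Y.inl_mul_cancel (m := φ' m * φ' n) ?_)
  rw [← inl_mul_mul_inl_mul, ← map_mul φ', hθ, hθ, hθ, map_mul]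

/-- The restriction to the kernel of a homomorphism to an abelian group. -/
def restrictKer (θ : M →* Multiplicative B) : A →+ B :=
  AddMonoidHom.mk' (fun a => (θ (X.inl (.ofAdd a))).toAdd) fun a b => by
    rw [inl_add, map_mul, toAdd_mul]

/-- Apply θ to c(g,h)·s(gh) = s(g)s(h). Thus θ turns the factor set into a coboundary, which is
invisible on cycles; the uniqueness statements rest on this. -/
lemma restrictKer_factorSet (θ : M →* Multiplicative B) (s : X.Section) (g h : G) :
    X.restrictKer θ (X.factorSet s g h) =
      (θ (s.toFun g)).toAdd + (θ (s.toFun h)).toAdd - (θ (s.toFun (g * h))).toAdd := by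
  rw [← toAdd_mul, ← map_mul, ← X.inl_factorSet_mul, map_mul, toAdd_mul, add_sub_cancel_right]
  rfl

/-- A homomorphism from a central extension of a perfect group to an abelian group is determined by
its restriction to the kernel. -/
lemma eq_one_of_restrictKer_eq_zero [Group.IsPerfect G] (θ : M →* Multiplicative B)
    (h : X.restrictKer θ = 0) (m : M) : θ m = 1 := by
  have hA (a : A) : θ (X.inl (.ofAdd a)) = 1 := DFunLike.congr_fun h a
  let s : X.Section := X.toGroupExtension.surjInvRightHom
  -- Once θ kills the kernel, it no longer sees the factor set, so θ∘s is multiplicative on the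
  -- perfect group.
  let μ : G →* Multiplicative B := MonoidHom.mk' (fun g => θ (s.toFun g)) fun g h => by
    rw [← map_mul, ← X.inl_factorSet_mul, map_mul, hA, one_mul]
  obtain ⟨a, ha⟩ := X.exists_inl_mul_section s m
  rw [← ha, map_mul, hA, one_mul]
  exact monoidHom_eq_one_of_isPerfect μ _

end CentralExt

/-! ### Structure maps compared with a section -/

namespace CentralFExt

variable {Γ G A M : Type*} [Group Γ] [Group G] [AddCommGroup A] [Group M] {f : Γ →* G}
  (X : CentralFExt f A M)

lemma inl_strCochain_mul (s : X.Section) (γ : Γ) :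
    X.inl (.ofAdd (X.strCochain s γ)) * X.str γ = s.toFun (f γ) :=
  X.inl_diff_mul _ _ _

/-- On `Γ`, the factor set is the coboundary of `strCochain`. -/
lemma factorSet_eq (s : X.Section) (γ γ' : Γ) :
    X.factorSet s (f γ) (f γ') =
      X.strCochain s γ + X.strCochain s γ' - X.strCochain s (γ * γ') := by
  rw [eq_sub_iff_add_eq]
  apply X.inl_mul_cancel (m := X.str γ * X.str γ')
  have h := X.inl_mul_mul_inl_mul (X.strCochain s γ) (X.strCochain s γ') (X.str γ) (X.str γ')
  rw [inl_strCochain_mul, inl_strCochain_mul, ← X.inl_factorSet_mul, ← map_mul f,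
    ← X.inl_strCochain_mul, ← mul_assoc, ← X.inl_add, map_mul X.str] at h
  exact h

end CentralFExt

/-! ### The universal Schur extension -/

namespace CentralExt

variable {P : Type u} [Group P] {A B M N E : Type*} [AddCommGroup A] [AddCommGroup B] [Group M]
  [Group N] [Group E]

variable {X : CentralExt (schurH2 P) E P} (hX : X.IsSchur)
include hX

/-- Every element of H₂(P) is the value of the factor set on a cycle representing it; the
universality of E enters the arguments in this form. -/
lemma IsSchur.homologyπ_eq (s : X.Section) (z : (barChains P).cycles 2) :
    (barChains P).homologyπ 2 z = evalChain₂ (X.factorSet s) ((barChains P).iCycles 2 z) :=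
  hX s z

/-- A homomorphism from `H₂(P)` under which the factor set becomes a coboundary is zero. -/
lemma IsSchur.eq_zero_of_coboundary (s : X.Section) (α : schurH2 P →+ B) (w : P → B)
    (h : ∀ g h, α (X.factorSet s g h) = w g + w h - w (g * h)) : α = 0 := by
  ext a
  obtain ⟨z, rfl⟩ := homologyπ_surjective (barChains P) 2 a
  rw [hX.homologyπ_eq s, map_evalChain₂]
  simp only [h]
  exact evalChain₂_coboundary_iCycles w z

lemma IsSchur.monoidHom_ext [Group.IsPerfect P] {Y : CentralExt B N P} {e e' : E →* N}
    (he : Y.rightHom.comp e = X.rightHom) (he' : Y.rightHom.comp e' = X.rightHom) : e = e' := by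
  obtain ⟨θ, hθ⟩ := exists_eq_inl_mul (he.trans he'.symm)
  have h0 : X.restrictKer θ = 0 := hX.eq_zero_of_coboundary X.toGroupExtension.surjInvRightHom _
    (fun g => (θ (X.toGroupExtension.surjInvRightHom.toFun g)).toAdd)
    (X.restrictKer_factorSet θ _)
  ext m
  rw [hθ, X.eq_one_of_restrictKer_eq_zero θ h0, map_one, one_mul]

/-- Both j∘c_X and c_Y evaluate to j on cycles, so their difference is a coboundary. One section of
Y suffices for this. -/
lemma IsSchur.exists_monoidHom [Group.IsPerfect P] (Y : CentralExt B N P) (t : Y.Section)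
    (j : schurH2 P →+ B) (hj : ∀ z, j ((barChains P).homologyπ 2 z) =
      evalChain₂ (Y.factorSet t) ((barChains P).iCycles 2 z)) :
    ∃ e : E →* N, Y.rightHom.comp e = X.rightHom ∧
      ∀ a, e (X.inl (.ofAdd a)) = Y.inl (.ofAdd (j a)) := by
  let s : X.Section := X.toGroupExtension.surjInvRightHom
  obtain ⟨w, hw⟩ := exists_coboundary_of_isPerfect
    (fun g h => j (X.factorSet s g h) - Y.factorSet t g h) (fun x hx => by
      obtain ⟨z, rfl⟩ := exists_iCycles_eq (barChains P) 1 x hx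
      rw [evalChain₂_sub, ← map_evalChain₂, ← hX.homologyπ_eq, hj, sub_self])
  obtain ⟨φ, h₁, h₂, -⟩ := CentralExt.exists_monoidHom s t j w hw
  exact ⟨φ, h₁, h₂⟩

end CentralExt

/-! ### Relative 2-cycles -/

section RelativeCycles

variable {Γ P : Type u} [Group Γ] [Group P] {f : Γ →* P}

lemma relFst_d (b : (relChains f).X 3) :
    relFst f ((relChains f).d 3 2 b) =
      (barMap f).f 2 (HomologicalComplex.homotopyCofiber.fstX (barMap f) 3 2 rfl b) +
        (barChains P).d 3 2 (HomologicalComplex.homotopyCofiber.sndX (barMap f) 3 b) :=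
  sndX_d_apply f 2 b

lemma relSnd_d (b : (relChains f).X 3) :
    relSnd f ((relChains f).d 3 2 b) =
      -(barChains Γ).d 2 1 (HomologicalComplex.homotopyCofiber.fstX (barMap f) 3 2 rfl b) :=
  fstX_d_apply f 1 b

lemma relFst_d_relMk (x : (barChains P).X 3) (y : (barChains Γ).X 2) :
    relFst f ((relChains f).d 3 2 (relMk f 2 x y)) = (barMap f).f 2 y + (barChains P).d 3 2 x := by
  refine (sndX_d_apply f 2 _).trans ?_
  rw [fstX_relMk, sndX_relMk]

lemma relSnd_d_relMk (x : (barChains P).X 3) (y : (barChains Γ).X 2) :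
    relSnd f ((relChains f).d 3 2 (relMk f 2 x y)) = -(barChains Γ).d 2 1 y := by
  refine (fstX_d_apply f 1 _).trans ?_
  rw [fstX_relMk]

/-- The equation for a relative 2-cycle. -/
lemma relCycle_eq (z : (relChains f).cycles 2) :
    (barMap f).f 1 (relSnd f ((relChains f).iCycles 2 z)) +
      (barChains P).d 2 1 (relFst f ((relChains f).iCycles 2 z)) = 0 := by
  refine (sndX_d_apply f 1 _).symm.trans ?_
  rw [d_iCycles_apply, map_zero]

/-- Relative 2-cycles are the pairs `(x, y)` with `f y + d x = 0`. -/
lemma exists_relCycle (x : (barChains P).X 2) (y : (barChains Γ).X 1)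
    (h : (barMap f).f 1 y + (barChains P).d 2 1 x = 0) :
    ∃ z, relFst f ((relChains f).iCycles 2 z) = x ∧ relSnd f ((relChains f).iCycles 2 z) = y := by
  obtain ⟨z, hz⟩ := exists_iCycles_eq (relChains f) 1 (relMk f 1 x y) (by
    apply relChains_ext f 0
    · rw [sndX_d_apply, fstX_relMk, sndX_relMk, h, map_zero]
    -- The second component imposes no condition: every 1-chain of Γ is a cycle, the coefficients
    -- being trivial.
    · rw [fstX_d_apply, fstX_relMk, barChains_d_one_zero, neg_zero, map_zero])
  exact ⟨z, (congrArg _ hz).trans (sndX_relMk f 1 x y), (congrArg _ hz).trans (fstX_relMk f 1 x y)⟩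

lemma iCycles_cyclesMap_inr (z : (barChains P).cycles 2) :
    relFst f ((relChains f).iCycles 2 (HomologicalComplex.cyclesMap
        (HomologicalComplex.homotopyCofiber.inr (barMap f)) 2 z)) = (barChains P).iCycles 2 z ∧
      relSnd f ((relChains f).iCycles 2 (HomologicalComplex.cyclesMap
        (HomologicalComplex.homotopyCofiber.inr (barMap f)) 2 z)) = 0 := by
  rw [iCycles_cyclesMap_apply]
  exact ⟨ConcreteCategory.congr_hom
      (HomologicalComplex.homotopyCofiber.inrX_sndX (barMap f) 2) ((barChains P).iCycles 2 z),
    ConcreteCategory.congr_hom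
      (HomologicalComplex.homotopyCofiber.inrX_fstX (barMap f) 2 1 rfl) ((barChains P).iCycles 2 z)⟩

lemma toRelH2_homologyπ (z : (barChains P).cycles 2) :
    toRelH2 f ((barChains P).homologyπ 2 z) = (relChains f).homologyπ 2
      (HomologicalComplex.cyclesMap (HomologicalComplex.homotopyCofiber.inr (barMap f)) 2 z) :=
  homologyMap_homologyπ_apply _ 2 z

end RelativeCycles

/-! ### The universal central `f`-extension -/

namespace CentralFExt

variable {Γ P : Type u} [Group Γ] [Group P] {f : Γ →* P} {B N U : Type*} [AddCommGroup B]
  [Group N] [Group U]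

/-- `HasClass` for a single section. -/
def HasClassAt {Γ G : Type u} [Group Γ] [Group G] {f : Γ →* G} {A M : Type*}
    [AddCommGroup A] [Group M] (X : CentralFExt f A M) (s : X.Section) (χ : relH2 f →+ A) : Prop :=
  ∀ z : (relChains f).cycles 2,
    χ ((relChains f).homologyπ 2 z) =
      evalChain₂ (X.factorSet s) (relFst f ((relChains f).iCycles 2 z)) +
        evalChain₁ (X.strCochain s) (relSnd f ((relChains f).iCycles 2 z))

/-- On relative cycles (z, 0) the cochain v contributes nothing, so the relative class restricts to
that of the underlying central extension. -/
lemma HasClassAt.toRelH2_homologyπ {Y : CentralFExt f B N} {s : Y.Section} {χ : relH2 f →+ B}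
    (h : Y.HasClassAt s χ) (z : (barChains P).cycles 2) :
    χ (toRelH2 f ((barChains P).homologyπ 2 z)) =
      evalChain₂ (Y.factorSet s) ((barChains P).iCycles 2 z) := by
  rw [_root_.toRelH2_homologyπ, h, (iCycles_cyclesMap_inr z).1, (iCycles_cyclesMap_inr z).2]
  exact (congrArg _ (map_zero (evalHom₁ (Y.strCochain s)))).trans (add_zero _)

variable [Group.IsPerfect P]

/-- The difference θ is trivial on the image of Γ, so θ∘v is the pullback of w = θ∘s. On a relative
cycle (x, y) the pair therefore evaluates to w(dx + f y) = 0, and θ vanishes on the kernel. -/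
lemma IsUniversal.monoidHom_ext {Y : CentralFExt f (relH2 f) U} (hY : Y.IsUniversal)
    {X : CentralExt B N P} {p p' : U →* N} (hp : X.rightHom.comp p = Y.rightHom)
    (hp' : X.rightHom.comp p' = Y.rightHom) (h : p.comp Y.str = p'.comp Y.str) : p = p' := by
  obtain ⟨θ, hθ⟩ := CentralExt.exists_eq_inl_mul (hp.trans hp'.symm)
  let s : Y.Section := Y.toGroupExtension.surjInvRightHom
  have hstr (γ : Γ) : θ (Y.str γ) = 1 := by
    have h1 : p (Y.str γ) = p' (Y.str γ) := DFunLike.congr_fun h γ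
    rw [hθ, mul_eq_right] at h1
    exact (map_eq_one_iff _ X.inl_injective).1 h1
  have hv (γ : Γ) : Y.restrictKer θ (Y.strCochain s γ) = (θ (s.toFun (f γ))).toAdd := by
    rw [← Y.inl_strCochain_mul s, map_mul, hstr, mul_one]
    rfl
  have h0 : Y.restrictKer θ = 0 := by
    ext a
    obtain ⟨z, rfl⟩ := homologyπ_surjective (relChains f) 2 a
    have hz : (relChains f).homologyπ 2 z = _ := hY s z
    rw [hz, map_add, map_evalChain₂, map_evalChain₁]
    simp only [Y.restrictKer_factorSet, hv]
    rw [← evalChain₁_d (fun g => (θ (s.toFun g)).toAdd),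
      ← evalChain₁_barMap f (fun g => (θ (s.toFun g)).toAdd), add_comm]
    refine (map_add (evalHom₁ fun g => (θ (s.toFun g)).toAdd) _ _).symm.trans ?_
    rw [relCycle_eq]
    exact map_zero _
  ext m
  rw [hθ, Y.eq_one_of_restrictKer_eq_zero θ h0, map_one, one_mul]

lemma IsUniversal.exists_monoidHom {Y : CentralFExt f (relH2 f) U} (hY : Y.IsUniversal)
    {Z : CentralFExt f B N} {t : Z.Section} {χ : relH2 f →+ B} (hχ : Z.HasClassAt t χ) :
    ∃ p : U →* N, Z.rightHom.comp p = Y.rightHom ∧ p.comp Y.str = Z.str ∧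
      ∀ a, p (Y.inl (.ofAdd a)) = Z.inl (.ofAdd (χ a)) := by
  let s : Y.Section := Y.toGroupExtension.surjInvRightHom
  have hY' : Y.HasClassAt s (AddMonoidHom.id _) := hY s
  have hrel (z : (relChains f).cycles 2) :
      evalChain₂ (fun g h => χ (Y.factorSet s g h) - Z.factorSet t g h)
          (relFst f ((relChains f).iCycles 2 z)) +
        evalChain₁ (fun γ => χ (Y.strCochain s γ) - Z.strCochain t γ)
          (relSnd f ((relChains f).iCycles 2 z)) = 0 := by
    have h := hχ z
    have hz : (relChains f).homologyπ 2 z = _ := hY s z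
    rw [hz, map_add, map_evalChain₂, map_evalChain₁] at h
    rw [evalChain₂_sub, evalChain₁_sub, sub_add_sub_comm, h, sub_self]
  obtain ⟨w, hw⟩ := exists_coboundary_of_isPerfect
    (fun g h => χ (Y.factorSet s g h) - Z.factorSet t g h) (fun x hx => by
      obtain ⟨z, rfl⟩ := exists_iCycles_eq (barChains P) 1 x hx
      have h := hχ.toRelH2_homologyπ z
      have hz : toRelH2 f ((barChains P).homologyπ 2 z) = _ := hY'.toRelH2_homologyπ z
      rw [hz, map_evalChain₂] at h
      rw [evalChain₂_sub, h, sub_self])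
  -- Perfectness gives x with dx = -f[γ], so (x, [γ]) is a relative cycle. Evaluating on it yields
  -- χ(v_Y(γ)) - v_Z(γ) = w(f(γ)): the w found from the factor sets already matches the structure
  -- maps.
  have hvw (γ : Γ) : χ (Y.strCochain s γ) = w (f γ) + Z.strCochain t γ := by
    obtain ⟨x, hx⟩ := exists_d_eq_of_isPerfect (-(barMap f).f 1 (barOne γ))
    obtain ⟨z, hz₁, hz₂⟩ := exists_relCycle (f := f) x (barOne γ) (by rw [hx, add_neg_cancel])
    have h := hrel z
    rw [hz₁, hz₂, evalChain₁_barOne] at h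
    simp only [hw] at h
    rw [← evalChain₁_d, hx] at h
    have h1 : evalChain₁ w (-(barMap f).f 1 (barOne γ)) = -w (f γ) :=
      (map_neg (evalHom₁ w) _).trans (congrArg Neg.neg
        ((evalChain₁_barMap f w (barOne γ)).trans (evalChain₁_barOne _ γ)))
    rw [h1] at h
    rw [← sub_eq_iff_eq_add, ← sub_eq_zero, ← h]
    abel
  obtain ⟨φ, h₁, h₂, h₃⟩ := CentralExt.exists_monoidHom s t χ w hw
  refine ⟨φ, h₁, MonoidHom.ext fun γ => ?_, h₂⟩
  have h := congrArg φ (Y.inl_strCochain_mul s γ)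
  rw [map_mul, h₂, h₃, ← Z.inl_strCochain_mul, ← mul_assoc, ← Z.inl_add, hvw] at h
  exact mul_left_cancel h

end CentralFExt

/-! ### Lifts to the universal Schur extension -/

section Lift

variable {Γ P : Type u} [Group Γ] [Group P] {f : Γ →* P} {E : Type*} [Group E]
  {X : CentralExt (schurH2 P) E P}

/-- The central extension `X` with a lift of `f` as its structure map. -/
def CentralExt.withLift (X : CentralExt (schurH2 P) E P) (lift : Γ →* E)
    (h : X.rightHom.comp lift = f) : CentralFExt f (schurH2 P) E where
  toCentralExt := X
  str := lift
  rightHom_comp_str := h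

/-- A central `f`-extension has a class as soon as the underlying central extension has one. -/
lemma CentralFExt.exists_hasClassAt {B N : Type*} [AddCommGroup B] [Group N]
    (Z : CentralFExt f B N) (s : Z.Section) (j : schurH2 P →+ B)
    (hj : ∀ z, j ((barChains P).homologyπ 2 z) =
      evalChain₂ (Z.factorSet s) ((barChains P).iCycles 2 z)) :
    ∃ χ, Z.HasClassAt s χ := by
  refine exists_addMonoidHom_homology 2
    ((evalHom₂ (Z.factorSet s)).comp (relFst f).hom.toAddMonoidHom +
      (evalHom₁ (Z.strCochain s)).comp (relSnd f).hom.toAddMonoidHom) fun z hz => ?_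
  obtain ⟨b, hb⟩ := (homologyπ_eq_zero_iff _ 2 z).1 hz
  rw [← hb]
  change evalHom₂ (Z.factorSet s) (relFst f ((relChains f).d 3 2 b)) +
    evalHom₁ (Z.strCochain s) (relSnd f ((relChains f).d 3 2 b)) = 0
  rw [relFst_d, relSnd_d]
  -- A relative boundary has components f y + dx and -dy. On Γ the factor set is δv, so the two
  -- contributions of y cancel.
  have hv (y : (barChains Γ).X 2) : evalHom₂ (Z.factorSet s) ((barMap f).f 2 y) =
      evalHom₁ (Z.strCochain s) ((barChains Γ).d 2 1 y) := by
    refine (evalChain₂_barMap f (Z.factorSet s) y).trans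
      (.trans ?_ (evalChain₁_d (Z.strCochain s) y).symm)
    simp only [Z.factorSet_eq]
  -- The factor set vanishes on boundaries because its evaluation on cycles factors through homology
  -- via `j`.
  have hd : evalChain₂ (Z.factorSet s) ((barChains P).d 3 2
      (HomologicalComplex.homotopyCofiber.sndX (barMap f) 3 b)) = 0 := by
    obtain ⟨z', hz'⟩ := exists_iCycles_eq (barChains P) 1 _
      (ConcreteCategory.congr_hom ((barChains P).d_comp_d 3 2 1)
        (HomologicalComplex.homotopyCofiber.sndX (barMap f) 3 b))
    have h0 := (homologyπ_eq_zero_iff _ 2 z').2 ⟨_, hz'.symm⟩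
    exact (congrArg (evalChain₂ (Z.factorSet s)) hz').symm.trans
      ((hj z').symm.trans ((congrArg j h0).trans (map_zero j)))
  refine (congrArg₂ (· + ·) ((map_add _ _ _).trans (congrArg₂ (· + ·) (hv _) hd))
    (map_neg _ _)).trans ?_
  rw [add_zero]
  exact add_neg_cancel _

lemma CentralExt.IsSchur.exists_hasClassAt (hX : X.IsSchur) (lift : Γ →* E)
    (h : X.rightHom.comp lift = f) (s : X.Section) :
    ∃ χ, (X.withLift lift h).HasClassAt s χ :=
  (X.withLift lift h).exists_hasClassAt s (AddMonoidHom.id _) (hX s)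

/-- A lift of `f` yields a retraction of `H₂(P) → H₂(P, Γ)`. -/
lemma CentralExt.IsSchur.exists_retraction (hX : X.IsSchur)
    (h : ∃ lift : Γ →* E, X.rightHom.comp lift = f) :
    ∃ χ : relH2 f →+ schurH2 P, ∀ a, χ (toRelH2 f a) = a := by
  obtain ⟨lift, h⟩ := h
  obtain ⟨χ, hχ⟩ := hX.exists_hasClassAt lift h X.toGroupExtension.surjInvRightHom
  refine ⟨χ, fun a => ?_⟩
  obtain ⟨z, rfl⟩ := homologyπ_surjective (barChains P) 2 a
  exact (hχ.toRelH2_homologyπ z).trans (hX.homologyπ_eq _ z).symm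

/-- Reduces the vanishing of H₂(f) to showing that the factor set pulled back to Γ is a coboundary.
-/
lemma CentralExt.IsSchur.schurH2Map_homologyπ (hX : X.IsSchur) (s : X.Section) (f : Γ →* P)
    (z : (barChains Γ).cycles 2) : schurH2Map f ((barChains Γ).homologyπ 2 z) =
      evalChain₂ (fun γ γ' => X.factorSet s (f γ) (f γ')) ((barChains Γ).iCycles 2 z) := by
  refine (homologyMap_homologyπ_apply (barMap f) 2 z).trans ?_
  rw [hX.homologyπ_eq s, iCycles_cyclesMap_apply, evalChain₂_barMap]

lemma schurH2Map_eq_zero (h : ∀ z, schurH2Map f ((barChains Γ).homologyπ 2 z) = 0) :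
    schurH2Map f = 0 := by
  refine ModuleCat.hom_ext (LinearMap.ext fun a => ?_)
  obtain ⟨z, rfl⟩ := homologyπ_surjective (barChains Γ) 2 a
  exact h z

/-- If `f` lifts to the universal Schur extension, then `H₂(f)` vanishes. -/
lemma CentralExt.IsSchur.schurH2Map_eq_zero_of_lift (hX : X.IsSchur)
    (h : ∃ lift : Γ →* E, X.rightHom.comp lift = f) : schurH2Map f = 0 := by
  obtain ⟨lift, h⟩ := h
  refine schurH2Map_eq_zero fun z => ?_
  let s : X.Section := X.toGroupExtension.surjInvRightHom
  rw [hX.schurH2Map_homologyπ s]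
  have hc (γ γ' : Γ) : X.factorSet s (f γ) (f γ') = _ :=
    (X.withLift lift h).factorSet_eq s γ γ'
  simp only [hc]
  exact evalChain₂_coboundary_iCycles _ z

/-- For a homomorphism from a cyclic group to `P`, the induced map on `H₂` vanishes. -/
lemma CentralExt.IsSchur.schurH2Map_eq_zero_of_isCyclic [IsCyclic Γ] (hX : X.IsSchur)
    (f : Γ →* P) : schurH2Map f = 0 := by
  -- Characters to ℚ/ℤ separate the elements of H₂(P), so it is enough to treat one character χ at a
  -- time.
  refine schurH2Map_eq_zero fun z => CharacterModule.eq_zero_of_character_apply fun χ => ?_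
  let s : X.Section := X.toGroupExtension.surjInvRightHom
  -- the preimage of the image of `f` is abelian, so that characters extend to it
  let M : Subgroup E := f.range.comap X.rightHom
  let q : M →* f.range := X.rightHom.subgroupComap f.range
  have hq : q.ker ≤ Subgroup.center M := fun m hm => Subgroup.mem_center_iff.2 fun n => by
    have hm' : (m : E) ∈ X.rightHom.ker := congrArg Subtype.val hm
    rw [← X.range_inl_eq_ker_rightHom] at hm'
    exact Subtype.ext (Subgroup.mem_center_iff.1 (X.central hm') n)
  have : IsCyclic f.range := isCyclic_of_surjective f.rangeRestrict f.rangeRestrict_surjective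
  let : CommGroup M := commGroupOfCyclicCenterQuotient q hq
  let i : schurH2 P →+ Additive M := AddMonoidHom.mk'
    (fun a => .ofMul ⟨X.inl (.ofAdd a), 1, by simp [X.toGroupExtension.rightHom_inl]⟩)
    fun a b => congrArg Additive.ofMul (Subtype.ext (X.inl_add a b))
  have hi : Function.Injective i.toIntLinearMap := fun a b hab =>
    Multiplicative.ofAdd.injective (X.inl_injective
      (congrArg (fun m : Additive M => (m.toMul : E)) hab))
  -- Divisibility of ℚ/ℤ extends χ from H₂(P) to the abelian group `M`; then χ∘c on Γ is the
  -- coboundary of θ∘s∘f.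
  obtain ⟨θ, hθ⟩ := CharacterModule.dual_surjective_of_injective i.toIntLinearMap hi χ
  have hθ' (a : schurH2 P) : χ a = θ (i a) := (DFunLike.congr_fun hθ a).symm
  let t (γ : Γ) : M := ⟨s.toFun (f γ), γ, (s.rightInverse_rightHom _).symm⟩
  have hc (γ γ' : Γ) : χ (X.factorSet s (f γ) (f γ')) =
      θ (.ofMul (t γ)) + θ (.ofMul (t γ')) - θ (.ofMul (t (γ * γ'))) := by
    rw [hθ', eq_sub_iff_add_eq, ← map_add, ← map_add]
    refine congrArg θ (congrArg Additive.ofMul (Subtype.ext ?_))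
    have := X.inl_factorSet_mul s (f γ) (f γ')
    rwa [← map_mul f] at this
  rw [hX.schurH2Map_homologyπ s]
  refine (map_evalChain₂ χ _ _).trans ?_
  refine (congrArg (fun c => evalChain₂ c ((barChains Γ).iCycles 2 z))
    (funext₂ hc)).trans ?_
  exact evalChain₂_coboundary_iCycles (fun γ => θ (.ofMul (t γ))) z

end Lift

/-! ### The exact sequence of the pair -/

section Sequence

variable {Γ P : Type u} [Group Γ] [Group P] (f : Γ →* P)

lemma relH2ToAb_homologyπ (z : (relChains f).cycles 2) :
    relH2ToAb f ((relChains f).homologyπ 2 z) =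
      chainsToAb Γ (relSnd f ((relChains f).iCycles 2 z)) := by
  have h : (relChains f).homologyπ 2 ≫ relH2ToAb f =
      (relChains f).iCycles 2 ≫ relSnd f ≫ chainsToAb Γ := by
    simp [relH2ToAb]
  exact ConcreteCategory.congr_hom h z

/-- If (z, 0) = d(x, y), then dy = 0 and z = f y + dx. The cycle f y bounds because H₂(f) = 0, hence
so does z. -/
lemma toRelH2_injective (h : schurH2Map f = 0) : Function.Injective (toRelH2 f) := by
  rw [injective_iff_map_eq_zero]
  intro a ha
  obtain ⟨z, rfl⟩ := homologyπ_surjective (barChains P) 2 a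
  rw [toRelH2_homologyπ] at ha
  obtain ⟨b, hb⟩ := (homologyπ_eq_zero_iff _ 2 _).1 ha
  have h₁ := (iCycles_cyclesMap_inr (f := f) z).1
  have h₂ := (iCycles_cyclesMap_inr (f := f) z).2
  rw [← hb, relFst_d] at h₁
  rw [← hb, relSnd_d, neg_eq_zero] at h₂
  obtain ⟨y, hy⟩ := exists_iCycles_eq (barChains Γ) 1 _ h₂
  have h₃ : schurH2Map f ((barChains Γ).homologyπ 2 y) = 0 := by
    rw [h]
    rfl
  obtain ⟨b', hb'⟩ := (homologyπ_eq_zero_iff _ 2 _).1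
    ((homologyMap_homologyπ_apply (barMap f) 2 y).symm.trans h₃)
  rw [iCycles_cyclesMap_apply, hy] at hb'
  exact (homologyπ_eq_zero_iff _ 2 z).2 ⟨b' + _, (map_add _ _ _).trans ((congrArg (· + _) hb').trans h₁)⟩

/-- For a relative cycle (x, dy) the chain x + f y is a cycle of P, and (x + f y, 0) - (x, dy) =
d(0, y). -/
lemma exact_toRelH2_relH2ToAb : Function.Exact (toRelH2 f) (relH2ToAb f) := by
  intro a
  constructor
  · intro ha
    obtain ⟨z, rfl⟩ := homologyπ_surjective (relChains f) 2 a
    rw [relH2ToAb_homologyπ] at ha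
    obtain ⟨y, hy⟩ := exists_d_eq_of_chainsToAb_eq_zero _ ha
    have hz := relCycle_eq z
    set x := relFst f ((relChains f).iCycles 2 z) with hx
    obtain ⟨z', hz'⟩ := exists_iCycles_eq (barChains P) 1 (x + (barMap f).f 2 y) (by
      rw [map_add, ← hz, ← hy, add_comm ((barMap f).f 1 _)]
      exact congrArg (_ + ·) (ConcreteCategory.congr_hom ((barMap f).comm 2 1) y))
    refine ⟨(barChains P).homologyπ 2 z', ?_⟩
    rw [toRelH2_homologyπ, ← sub_eq_zero, ← map_sub, homologyπ_eq_zero_iff]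
    rw [map_sub]
    refine ⟨relMk f 2 0 y, relChains_ext f 1 ?_ ?_⟩
    · refine (relFst_d_relMk _ _).trans (.trans ?_ ((relFst f).hom.map_sub _ _).symm)
      rw [map_zero, add_zero]
      change _ = relFst f _ - relFst f _
      rw [(iCycles_cyclesMap_inr (f := f) z').1, hz', ← hx, add_sub_cancel_left]
    · refine (relSnd_d_relMk _ _).trans (.trans ?_ ((relSnd f).hom.map_sub _ _).symm)
      change _ = relSnd f _ - relSnd f _
      rw [(iCycles_cyclesMap_inr (f := f) z').2, hy, zero_sub]
  · rintro ⟨a, rfl⟩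
    obtain ⟨z, rfl⟩ := homologyπ_surjective (barChains P) 2 a
    rw [toRelH2_homologyπ, relH2ToAb_homologyπ, (iCycles_cyclesMap_inr z).2, map_zero]

/-- As P is perfect, f[γ] bounds, so [γ] completes to a relative cycle. -/
lemma relH2ToAb_surjective [Group.IsPerfect P] : Function.Surjective (relH2ToAb f) := by
  intro c
  obtain ⟨γ, hγ⟩ := QuotientGroup.mk_surjective c.toMul
  obtain ⟨x, hx⟩ := exists_d_eq_of_isPerfect (-(barMap f).f 1 (barOne γ))
  obtain ⟨z, -, hz⟩ := exists_relCycle (f := f) x (barOne γ) (by rw [hx, add_neg_cancel])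
  refine ⟨(relChains f).homologyπ 2 z, ?_⟩
  rw [relH2ToAb_homologyπ, hz, chainsToAb_barOne]
  exact congrArg Additive.ofMul hγ

/-- A retraction of the first map of a short exact sequence yields a section of the second. -/
lemma exists_section_of_retraction {A B C : Type*} [AddCommGroup A] [AddCommGroup B]
    [AddCommGroup C] {i : A →+ B} {q : B →+ C} (hex : Function.Exact i q)
    (hq : Function.Surjective q) {r : B →+ A} (hr : ∀ a, r (i a) = a) :
    ∃ σ : C →+ B, q.comp σ = AddMonoidHom.id C := by
  -- The map id - i∘r kills the image of i, which is the kernel of q, so it descends along q to a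
  -- section.
  refine ⟨q.liftOfSurjective hq ⟨AddMonoidHom.id B - i.comp r, fun b hb => ?_⟩, ?_⟩
  · obtain ⟨a, rfl⟩ := (hex b).1 hb
    rw [AddMonoidHom.mem_ker]
    simp [hr]
  · ext c
    obtain ⟨b, rfl⟩ := hq c
    have h := q.liftOfRightInverse_comp_apply _ (Function.rightInverse_surjInv hq)
      ⟨AddMonoidHom.id B - i.comp r, fun b hb => by
        obtain ⟨a, rfl⟩ := (hex b).1 hb
        rw [AddMonoidHom.mem_ker]
        simp [hr]⟩ b
    refine (congrArg q h).trans ?_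
    simp [hex.apply_apply_eq_zero]

end Sequence

end

theorem mainTheorem5 {Γ P : Type u} [Group Γ] [Group P] [Group.IsPerfect P] (f : Γ →* P)
    {E : Type v} [Group E] (X : CentralExt (schurH2 P) E P) (hX : X.IsSchur) :
    -- for every map `f : Γ → P`
    (∀ {U : Type w} [Group U] (Y : CentralFExt f (relH2 f) U), Y.IsUniversal →
      -- there is exactly one map of central extensions `E → U`,
      -- and on kernels it is the natural map `H₂(P) → H₂(P, Γ)`
      ∃ e : E →* U,
        Y.rightHom.comp e = X.rightHom ∧
        (∀ e' : E →* U, Y.rightHom.comp e' = X.rightHom → e' = e) ∧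
        (∀ a : schurH2 P, e (X.inl (.ofAdd a)) = Y.inl (.ofAdd (toRelH2 f a))) ∧
        -- a lift of `f` to `E` induces exactly one map of `f`-extensions `U → E`,
        -- and this is a central extension of `E`, split by `e`
        ∀ lift : Γ →* E, X.rightHom.comp lift = f →
          ∃ p : U →* E,
            (X.rightHom.comp p = Y.rightHom ∧ p.comp Y.str = lift) ∧
            (∀ p' : U →* E, X.rightHom.comp p' = Y.rightHom → p'.comp Y.str = lift → p' = p) ∧
            p.ker ≤ Subgroup.center U ∧
            p.comp e = MonoidHom.id E) ∧
    -- if `f` lifts to `E`, then `H₂(Γ) → H₂(P)` is zero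
    ((∃ lift : Γ →* E, X.rightHom.comp lift = f) → schurH2Map f = 0) ∧
    -- for a cyclic group `C` the sequence `0 → H₂(P) → H₂(P, C) → C → 0` is exact,
    -- and it splits if `C → P` lifts to `E`
    (∀ (C : Type u) [CommGroup C] [IsCyclic C] (x : C →* P),
      Function.Injective (toRelH2 x) ∧
      Function.Exact (toRelH2 x) (relH2ToSelf x) ∧
      Function.Surjective (relH2ToSelf x) ∧
      ((∃ lift : C →* E, X.rightHom.comp lift = x) →
        ∃ σ : Additive C →+ relH2 x, (relH2ToSelf x).comp σ = AddMonoidHom.id (Additive C))) := by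
  refine ⟨fun {U} _ Y hY => ?_, hX.schurH2Map_eq_zero_of_lift, fun C _ _ x => ?_⟩
  · have hY' : Y.HasClassAt Y.toGroupExtension.surjInvRightHom (AddMonoidHom.id _) := hY _
    obtain ⟨e, he, hker⟩ := hX.exists_monoidHom Y.toCentralExt
      Y.toGroupExtension.surjInvRightHom (toRelH2 f).hom.toAddMonoidHom hY'.toRelH2_homologyπ
    refine ⟨e, he, fun e' he' => hX.monoidHom_ext he' he, hker, fun lift hlift => ?_⟩
    obtain ⟨χ, hχ⟩ := hX.exists_hasClassAt lift hlift X.toGroupExtension.surjInvRightHom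
    obtain ⟨p, hp, hstr, -⟩ := hY.exists_monoidHom hχ
    have hp : X.rightHom.comp p = Y.rightHom := hp
    refine ⟨p, ⟨hp, hstr⟩, fun p' hp' hstr' => hY.monoidHom_ext hp' hp (hstr'.trans hstr.symm),
      fun m hm => Y.central ?_, hX.monoidHom_ext (Y := X) ?_ (MonoidHom.comp_id _)⟩
    -- An element killed by p lies over 1 in P, hence in the central kernel of U → P.
    · rw [Y.range_inl_eq_ker_rightHom, MonoidHom.mem_ker, ← hp, MonoidHom.comp_apply,
        MonoidHom.mem_ker.1 hm, map_one]
    -- Both p∘e and the identity are endomorphisms of E over P, so uniqueness for the Schur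
    -- extension identifies them.
    · rw [← MonoidHom.comp_assoc, hp, he]
  · have hinj : Function.Injective (Abelianization.equivOfComm (H := C)).symm :=
      (Abelianization.equivOfComm (H := C)).symm.injective
    have hex : Function.Exact (toRelH2 x) (relH2ToSelf x) := fun a =>
      ⟨fun h => (exact_toRelH2_relH2ToAb x a).1 (hinj
        (h.trans (map_one (Abelianization.equivOfComm (H := C)).symm).symm)),
        fun h => (congrArg (Abelianization.equivOfComm (H := C)).symm
          ((exact_toRelH2_relH2ToAb x a).2 h)).trans
          (map_one (Abelianization.equivOfComm (H := C)).symm)⟩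
    have hsurj : Function.Surjective (relH2ToSelf x) :=
      (Abelianization.equivOfComm (H := C)).symm.surjective.comp (relH2ToAb_surjective x)
    refine ⟨toRelH2_injective x (hX.schurH2Map_eq_zero_of_isCyclic x), hex, hsurj, fun h => ?_⟩
    obtain ⟨r, hr⟩ := hX.exists_retraction h
    exact exists_section_of_retraction (i := (toRelH2 x).hom.toAddMonoidHom) hex hsurj hr
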